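/- Let $X_1,X_2,\dots$ be i.i.d. real random variables with common distribution $F_X$, and let $S_n=X_1+\cdots+X_n$. For $1<\alpha<2$, $\sigma\ge 0$ and $\mu\in\mathbb R$, let $S_\alpha(\sigma,0,\mu)$ denote the symmetric $\alpha$-stable law, i.e. the probability law on $\mathbb R$ with characteristic function $t\mapsto \exp(i\mu t-\sigma^\alpha|t|^\alpha)$. For $r>0$ and distributions $F,G$ on $\mathbb R$, let $$d_r(F,G)=\inf_{(X,Y)}\left(\mathbb E|X-Y|^r\right)^{1/r}\in[0,\infty]$$ be the Mallows distance, where the infimum is over all random vectors $(X,Y)$ with marginal distributions $F$ and $G$. Let $1<\alpha<2$, $\sigma>0$, $\mu\in\mathbb R$, $G_\alpha=S_\alpha(\sigma,0,\mu)$, and suppose that $d_\alpha(F_X,G_\alpha)<\infty$. Then $X_1$ is integrable and, with $\mu_X=\mathbb E X_1$: 1. $\dfrac{S_n-n\mu_X}{n^{1/\alpha}}$ converges in distribution to $S_\alpha(\sigma,0,0)$ as $n\to\infty$; 2. $S_n$ is approximately distributed as $S_\alpha(\sigma n^{1/\alpha},0,n\mu_X)$, in the sense that $$\sup_{x\in\mathbb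 R}\left|\mathbb P(S_n\le x)-\Phi_n(x)\right|\longrightarrow 0\qquad(n\to\infty),$$ where $\Phi_n$ is the distribution function of $S_\alpha(\sigma n^{1/\alpha},0,n\mu_X)$. -/

import Mathlib

open MeasureTheory ProbabilityTheory Filter Topology

noncomputable section

/-- The logarithm of the characteristic function of the stable law `S_α(σ, β, μ)`
(Samorodnitsky–Taqqu parametrization) at the point `t`. -/
def stableExponent (α σ β μ t : ℝ) : ℂ :=
  if α = 1 then
    -((σ * |t| : ℝ) : ℂ) *
        (1 + Complex.I * ((β * (2 / Real.pi) * Real.sign t * Real.log |t| : ℝ) : ℂ))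
      + Complex.I * ((μ * t : ℝ) : ℂ)
  else
    -((σ ^ α * |t| ^ α : ℝ) : ℂ) *
        (1 - Complex.I * ((β * Real.sign t * Real.tan (Real.pi * α / 2) : ℝ) : ℂ))
      + Complex.I * ((μ * t : ℝ) : ℂ)

/-- `ν` is the `α`-stable law `S_α(σ, β, μ)`, with scale `σ`, skewness `β` and shift `μ`. -/
def IsStableLaw (α σ β μ : ℝ) (ν : ProbabilityMeasure ℝ) : Prop :=
  ∀ t : ℝ, charFun (ν : Measure ℝ) t = Complex.exp (stableExponent α σ β μ t)

/-- The Mallows (Wasserstein) distance `d_r(F, G)`: the infimum of `(E|X - Y|^r)^(1/r)` over all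
joint laws `π` of pairs `(X, Y)` with marginals `F` and `G`; it may be infinite. -/
def mallowsDist (r : ℝ) (F G : Measure ℝ) : ENNReal :=
  ⨅ (π : Measure (ℝ × ℝ)) (_ : π.map Prod.fst = F) (_ : π.map Prod.snd = G),
    (∫⁻ p, ENNReal.ofReal (|p.1 - p.2| ^ r) ∂π) ^ (1 / r)

/-- The Kolmogorov (uniform) distance between the distribution functions of two laws on `ℝ`. -/
def kolmogorovDist (F G : Measure ℝ) : ℝ :=
  ⨆ x : ℝ, |cdf F x - cdf G x|

end

/-! Finite distance gives a coupling (X, Y) with E|X - Y|^α < ∞. Since α > 1, both the stable Y and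
X - Y are integrable, hence so is X. After centring, D = (X - EX) - (Y - μ) has mean zero and lies
in L^α, so sums of n copies of D are o(n^(1/α)) (`tendsto_charFun_pow_one`), while sums of n copies
of Y - μ, scaled by n^(-1/α), have exactly the law H = S_α(σ, 0, 0). The sums of X therefore inherit
the limit H.

The transfer goes through |φ_A - φ_B|² ≤ 2|1 - φ_(A-B)|, applied to sums over an n-fold product of
the coupling, and Lévy's continuity theorem. As H has no atoms, Pólya's theorem makes the
convergence uniform, and affine invariance of the Kolmogorov distance undoes the normalization. -/

lemma exists_coupling_of_mallowsDist_lt_top {r : ℝ} (hr : 0 < r) {F G : Measure ℝ}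
    (h : mallowsDist r F G < ⊤) :
    ∃ π : Measure (ℝ × ℝ), π.map Prod.fst = F ∧ π.map Prod.snd = G ∧
      ∫⁻ p, ENNReal.ofReal (|p.1 - p.2| ^ r) ∂π < ⊤ := by
  simp only [mallowsDist, iInf_lt_iff] at h
  obtain ⟨π, h1, h2, h3⟩ := h
  exact ⟨π, h1, h2, (ENNReal.rpow_lt_top_iff_of_pos (by positivity)).1 h3⟩

/-! ### First moments and symmetric stable laws. -/

/-- A law whose characteristic function satisfies `1 - φ(t) = O(|t| ^ α)` with `1 < α` has a finite
first moment. -/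
lemma integrable_id_of_norm_one_sub_charFun_le {ν : Measure ℝ} [IsProbabilityMeasure ν]
    {α C : ℝ} (hα : 1 < α) (h : ∀ t, ‖1 - charFun ν t‖ ≤ C * |t| ^ α) :
    Integrable (fun x : ℝ ↦ x) ν := by
  have hC : 0 ≤ C := by simpa using (norm_nonneg _).trans (h 1)
  -- The mean of 1 - φ over |t| ≤ 2/r controls the mass beyond r. The resulting r^(-α) is integrable
  -- at infinity because α > 1.
  have tail : ∀ r : ℝ, 0 < r → ν.real {x | r < |x|} ≤ 2 * C * 2 ^ α * r ^ (-α) := by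
    intro r hr
    have hb : ‖∫ t in (-2 * r⁻¹)..(2 * r⁻¹), 1 - charFun ν t‖
        ≤ (C * (2 * r⁻¹) ^ α) * |2 * r⁻¹ - -2 * r⁻¹| := by
      refine intervalIntegral.norm_integral_le_of_norm_le_const fun t ht ↦ (h t).trans ?_
      rw [Set.uIoc_of_le (by have := inv_pos.2 hr; linarith)] at ht
      have : |t| ≤ 2 * r⁻¹ := abs_le.2 ⟨by linarith [ht.1], ht.2⟩
      gcongr
    calc ν.real {x | r < |x|} ≤ 2⁻¹ * r * ‖∫ t in (-2 * r⁻¹)..(2 * r⁻¹), 1 - charFun ν t‖ :=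
          measureReal_abs_gt_le_integral_charFun hr
      _ ≤ 2⁻¹ * r * ((C * (2 * r⁻¹) ^ α) * |2 * r⁻¹ - -2 * r⁻¹|) := by gcongr
      _ = 2 * C * 2 ^ α * r ^ (-α) := by
          rw [Real.mul_rpow (by norm_num) (by positivity), Real.inv_rpow hr.le,
            ← Real.rpow_neg hr.le, abs_of_pos (by have := inv_pos.2 hr; linarith)]
          field_simp
          ring
  refine ⟨by fun_prop, ?_⟩
  rw [hasFiniteIntegral_iff_norm, lintegral_eq_lintegral_meas_lt ν
    (ae_of_all _ fun x ↦ norm_nonneg x) (by fun_prop), ← Set.Ioc_union_Ioi_eq_Ioi zero_le_one]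
  refine (lintegral_union_le _ _ _).trans_lt (ENNReal.add_lt_top.2 ⟨?_, ?_⟩)
  · calc ∫⁻ t in Set.Ioc (0 : ℝ) 1, ν {a | t < ‖a‖} ≤ ∫⁻ t in Set.Ioc (0 : ℝ) 1, 1 :=
          lintegral_mono fun t ↦ prob_le_one
      _ < ⊤ := by simp
  · have hint : IntegrableOn (fun t : ℝ ↦ 2 * C * 2 ^ α * t ^ (-α)) (Set.Ioi 1) :=
      (integrableOn_Ioi_rpow_of_lt (by linarith) zero_lt_one).const_mul _
    calc ∫⁻ t in Set.Ioi (1 : ℝ), ν {a | t < ‖a‖}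
        ≤ ∫⁻ t in Set.Ioi (1 : ℝ), ENNReal.ofReal (2 * C * 2 ^ α * t ^ (-α)) := by
          refine setLIntegral_mono (by fun_prop) fun t ht ↦ ?_
          rw [← ofReal_measureReal]
          exact ENNReal.ofReal_le_ofReal (tail t (zero_lt_one.trans ht))
      _ < ⊤ := hint.setLIntegral_lt_top

lemma stableExponent_zero_skew {α : ℝ} (hα : α ≠ 1) (σ μ t : ℝ) :
    stableExponent α σ 0 μ t = -((σ ^ α * |t| ^ α : ℝ) : ℂ) + Complex.I * ((μ * t : ℝ) : ℂ) := by
  simp [stableExponent, hα]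

lemma IsStableLaw.charFun_eq_ofReal {α σ : ℝ} (hα : α ≠ 1) {ν : ProbabilityMeasure ℝ}
    (h : IsStableLaw α σ 0 0 ν) (t : ℝ) :
    charFun (ν : Measure ℝ) t = (Real.exp (-(σ ^ α * |t| ^ α)) : ℂ) := by
  rw [h t, stableExponent_zero_skew hα]
  simp

lemma IsStableLaw.integrable_id {α σ : ℝ} (hα : 1 < α) (hσ : 0 ≤ σ) {ν : ProbabilityMeasure ℝ}
    (h : IsStableLaw α σ 0 0 ν) : Integrable (fun x : ℝ ↦ x) (ν : Measure ℝ) := by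
  refine integrable_id_of_norm_one_sub_charFun_le (C := σ ^ α) hα fun t ↦ ?_
  have hpos : 0 ≤ σ ^ α * |t| ^ α := by positivity
  rw [h.charFun_eq_ofReal hα.ne', ← Complex.ofReal_one, ← Complex.ofReal_sub, Complex.norm_real,
    Real.norm_of_nonneg (sub_nonneg.2 (Real.exp_le_one_iff.2 (by linarith)))]
  linarith [Real.add_one_le_exp (-(σ ^ α * |t| ^ α))]

lemma IsStableLaw.integral_id_eq_zero {α σ : ℝ} (hα : α ≠ 1) {ν : ProbabilityMeasure ℝ}
    (h : IsStableLaw α σ 0 0 ν) : ∫ x, x ∂(ν : Measure ℝ) = 0 := by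
  have hsymm : (ν : Measure ℝ).map (fun x ↦ (-1) * x) = ν := by
    have : IsProbabilityMeasure ((ν : Measure ℝ).map (fun x ↦ (-1) * x)) :=
      Measure.isProbabilityMeasure_map (by fun_prop)
    refine Measure.ext_of_charFun (funext fun t ↦ ?_)
    rw [charFun_map_mul, h.charFun_eq_ofReal hα, h.charFun_eq_ofReal hα]
    simp
  have : ∫ x, x ∂(ν : Measure ℝ) = -∫ x, x ∂(ν : Measure ℝ) := by
    conv_lhs => rw [← hsymm]
    rw [integral_map (by fun_prop) (by fun_prop)]
    simp_rw [neg_one_mul]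
    exact integral_neg _
  linarith

/-- An affine image of a symmetric stable law is a symmetric stable law. -/
lemma IsStableLaw.map_affine {α σ μ : ℝ} (hα : 1 < α) (hσ : 0 ≤ σ) {ν : ProbabilityMeasure ℝ}
    (h : IsStableLaw α σ 0 μ ν) {c : ℝ} (hc : 0 ≤ c) (b : ℝ) :
    IsStableLaw α (σ * c) 0 (c * μ + b)
      (ν.map (f := fun x ↦ c * x + b) (by fun_prop)) := by
  intro t
  have : (ν.map (f := fun x ↦ c * x + b) (by fun_prop) : Measure ℝ)
      = ((ν : Measure ℝ).map (fun x ↦ c * x)).map (fun x ↦ x + b) := by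
    rw [Measure.map_map (by fun_prop) (by fun_prop)]
    rfl
  rw [this, charFun_map_add_const, charFun_map_mul, h, ← Complex.exp_add,
    stableExponent_zero_skew hα.ne', stableExponent_zero_skew hα.ne', Real.mul_rpow hσ hc, abs_mul,
    Real.mul_rpow (abs_nonneg _) (abs_nonneg _), abs_of_nonneg hc]
  congr 1
  simp
  ring

/-! ### Normalized sums of a centred variable in L^α. -/

/-- Interpolates between the quadratic Taylor bound for |x| ≤ 1 and the linear bound for |x| ≥ 1. -/
lemma norm_exp_mul_I_sub_one_sub_le {p : ℝ} (hp₁ : 1 ≤ p) (hp₂ : p ≤ 2) (x : ℝ) :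
    ‖Complex.exp (x * Complex.I) - 1 - x * Complex.I‖ ≤ 2 * |x| ^ p := by
  have hn : ‖(x : ℂ) * Complex.I‖ = |x| := by simp
  rcases le_total |x| 1 with hx | hx
  · have h1 := Complex.norm_exp_sub_one_sub_id_le (x := x * Complex.I) (by rwa [hn])
    rw [hn, ← Real.rpow_two] at h1
    have h2 : |x| ^ (2 : ℝ) ≤ |x| ^ p :=
      Real.rpow_le_rpow_of_exponent_ge_of_imp (abs_nonneg x) hx hp₂ (by intro _ h; linarith)
    have h3 : 0 ≤ |x| ^ p := by positivity
    linarith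
  · have h1 : ‖Complex.exp (x * Complex.I) - 1‖ ≤ |x| := by
      simpa [mul_comm] using Real.norm_exp_I_mul_ofReal_sub_one_le (x := x)
    have h2 := norm_sub_le (Complex.exp (x * Complex.I) - 1) (x * Complex.I)
    rw [hn] at h2
    have h3 : |x| ≤ |x| ^ p := by
      simpa using Real.rpow_le_rpow_of_exponent_le hx hp₁
    linarith

lemma norm_pow_sub_one_le {z : ℂ} (hz : ‖z‖ ≤ 1) (n : ℕ) : ‖z ^ n - 1‖ ≤ n * ‖z - 1‖ := by
  induction n with
  | zero => simp
  | succ n ih =>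
    have : z ^ (n + 1) - 1 = z ^ n * (z - 1) + (z ^ n - 1) := by ring
    rw [this]
    refine (norm_add_le _ _).trans ?_
    rw [norm_mul, norm_pow]
    have h1 : ‖z‖ ^ n * ‖z - 1‖ ≤ 1 * ‖z - 1‖ := by
      gcongr
      exact pow_le_one₀ (norm_nonneg _) hz
    push_cast
    linarith

/-- If `D` is centred with a finite moment of order `α ∈ (1, 2)`, normalized sums of independent
copies of `D` by `n ^ (1 / α)` converge to zero, in terms of characteristic functions. -/
lemma tendsto_charFun_pow_one {Ω : Type*} [MeasurableSpace Ω] {Q : Measure Ω}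
    [IsProbabilityMeasure Q] {D : Ω → ℝ} {α : ℝ} (hα₁ : 1 < α) (hα₂ : α < 2)
    (hD : Integrable D Q) (hD₀ : ∫ ω, D ω ∂Q = 0) (hDα : Integrable (fun ω ↦ |D ω| ^ α) Q)
    (t : ℝ) :
    Tendsto (fun n : ℕ ↦ charFun (Q.map D) (((n : ℝ) ^ (1 / α))⁻¹ * t) ^ n) atTop (𝓝 1) := by
  have hα₀ : 0 < α := by linarith
  have hDm := hD.aemeasurable
  have hprob : IsProbabilityMeasure (Q.map D) := Measure.isProbabilityMeasure_map hDm
  set s : ℕ → ℝ := fun n ↦ ((n : ℝ) ^ (1 / α))⁻¹ * t with hs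
  set g : ℕ → Ω → ℂ := fun n ω ↦ Complex.exp ((s n * D ω : ℝ) * Complex.I) - 1
    - (s n * D ω : ℝ) * Complex.I with hg
  have hspow : ∀ n : ℕ, ∀ p : ℝ, 0 ≤ p → |s n| ^ p = (n : ℝ) ^ (-(p / α)) * |t| ^ p := by
    intro n p hp
    rw [hs]
    simp only
    rw [abs_mul, Real.mul_rpow (abs_nonneg _) (abs_nonneg _), abs_of_nonneg (by positivity),
      ← Real.rpow_neg (by positivity), ← Real.rpow_mul (by positivity)]
    congr 2
    ring
  have hgb : ∀ n : ℕ, n ≠ 0 → ∀ p : ℝ, 1 ≤ p → p ≤ 2 → ∀ ω,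
      ‖(n : ℂ) * g n ω‖ ≤ (n : ℝ) ^ (1 - p / α) * (2 * |t| ^ p * |D ω| ^ p) := by
    intro n hn p hp1 hp2 ω
    have hn' : (0 : ℝ) < n := by positivity
    rw [norm_mul, Complex.norm_natCast]
    calc (n : ℝ) * ‖g n ω‖ ≤ n * (2 * |s n * D ω| ^ p) := by
          gcongr
          exact norm_exp_mul_I_sub_one_sub_le hp1 hp2 _
      _ = _ := by
          rw [abs_mul, Real.mul_rpow (abs_nonneg _) (abs_nonneg _), hspow n p (by linarith),
            sub_eq_add_neg, Real.rpow_add hn', Real.rpow_one]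
          ring
  have hgint : ∀ n, ∫ ω, g n ω ∂Q = charFun (Q.map D) (s n) - 1 := by
    intro n
    have h1 : Integrable (fun ω ↦ Complex.exp ((s n * D ω : ℝ) * Complex.I)) Q := by
      refine Integrable.of_bound (C := 1) (by fun_prop) (ae_of_all _ fun ω ↦ ?_)
      rw [Complex.norm_exp_ofReal_mul_I]
    have h2 : Integrable (fun ω ↦ ((s n * D ω : ℝ) : ℂ) * Complex.I) Q :=
      ((hD.const_mul (s n)).ofReal).mul_const _
    rw [hg]
    simp only
    have h3 : Integrable (fun ω ↦ Complex.exp ((s n * D ω : ℝ) * Complex.I) - 1) Q :=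
      h1.sub (integrable_const _)
    rw [integral_sub h3 h2, integral_sub h1 (integrable_const _),
      integral_mul_const, integral_complex_ofReal, integral_const_mul, hD₀, charFun_apply_real,
      integral_map hDm (by fun_prop)]
    simp
  -- In `hgb`, p = α makes the power of n trivial and gives the dominating function; p = 2 gives
  -- n^(1 - 2/α) → 0 pointwise.
  have hlim : Tendsto (fun n : ℕ ↦ ∫ ω, (n : ℂ) * g n ω ∂Q) atTop (𝓝 (∫ _, (0 : ℂ) ∂Q)) := by
    refine tendsto_integral_of_dominated_convergence (fun ω ↦ 2 * |t| ^ α * |D ω| ^ α)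
      (fun n ↦ by fun_prop) (hDα.const_mul _) (fun n ↦ ae_of_all _ fun ω ↦ ?_)
      (ae_of_all _ fun ω ↦ ?_)
    · rcases eq_or_ne n 0 with rfl | hn
      · simp; positivity
      · simpa [div_self hα₀.ne'] using hgb n hn α hα₁.le hα₂.le ω
    · have h0 : Tendsto (fun n : ℕ ↦ (n : ℝ) ^ (1 - 2 / α) * (2 * |t| ^ (2 : ℝ) * |D ω| ^ (2 : ℝ)))
          atTop (𝓝 0) := by
        have : 0 < 2 / α - 1 := by
          rw [sub_pos, lt_div_iff₀ hα₀]; linarith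
        have h := (tendsto_rpow_neg_atTop this).comp tendsto_natCast_atTop_atTop
        simpa [neg_sub] using h.mul_const (2 * |t| ^ (2 : ℝ) * |D ω| ^ (2 : ℝ))
      refine squeeze_zero_norm' ?_ h0
      filter_upwards [eventually_ne_atTop 0] with n hn
      exact hgb n hn 2 one_le_two le_rfl ω
  rw [integral_zero, tendsto_zero_iff_norm_tendsto_zero] at hlim
  rw [tendsto_iff_norm_sub_tendsto_zero]
  refine squeeze_zero (fun _ ↦ norm_nonneg _) (fun n ↦ ?_) hlim
  rw [integral_const_mul, hgint, norm_mul, Complex.norm_natCast]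
  exact norm_pow_sub_one_le (norm_charFun_le_one _) n

/-! ### Perturbation of characteristic functions. -/

/-- Stability of the characteristic function under perturbation. -/
lemma sq_norm_charFun_map_sub_le {Ω : Type*} [MeasurableSpace Ω] {Q : Measure Ω}
    [IsProbabilityMeasure Q] {A B : Ω → ℝ} (hA : AEMeasurable A Q) (hB : AEMeasurable B Q)
    (t : ℝ) :
    ‖charFun (Q.map A) t - charFun (Q.map B) t‖ ^ 2
      ≤ 2 * ‖1 - charFun (Q.map (fun ω ↦ A ω - B ω)) t‖ := by
  have hi : ∀ {E : Ω → ℝ}, AEMeasurable E Q →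
      Integrable (fun ω ↦ Complex.exp (t * E ω * Complex.I)) Q := by
    intro E hE
    refine Integrable.of_bound (C := 1) (by fun_prop) (ae_of_all _ fun ω ↦ ?_)
    rw [← Complex.ofReal_mul, Complex.norm_exp_ofReal_mul_I]
  have hφ : ∀ {E : Ω → ℝ}, AEMeasurable E Q →
      charFun (Q.map E) t = ∫ ω, Complex.exp (t * E ω * Complex.I) ∂Q := by
    intro E hE
    rw [charFun_apply_real, integral_map hE (by fun_prop)]
  have hAB : AEMeasurable (fun ω ↦ A ω - B ω) Q := hA.sub hB
  set f : Ω → ℝ := fun ω ↦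
    ‖Complex.exp (t * A ω * Complex.I) - Complex.exp (t * B ω * Complex.I)‖ with hf
  have hfm : AEStronglyMeasurable f Q := ((hi hA).sub (hi hB)).norm.aestronglyMeasurable
  -- The identity |e^(ia) - e^(ib)|² = 2 Re(1 - e^(i(a-b))).
  have hf2 : ∀ ω, f ω ^ 2 = 2 * (1 - Complex.exp (t * (A ω - B ω : ℝ) * Complex.I)).re := by
    intro ω
    rw [hf]
    simp only
    rw [← Complex.normSq_eq_norm_sq, ← Complex.ofReal_mul, ← Complex.ofReal_mul,
      ← Complex.ofReal_mul, mul_sub, Complex.normSq_apply]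
    simp only [Complex.sub_re, Complex.sub_im, Complex.exp_ofReal_mul_I_re,
      Complex.exp_ofReal_mul_I_im, Complex.one_re, Real.cos_sub]
    nlinarith [Real.sin_sq_add_cos_sq (t * A ω), Real.sin_sq_add_cos_sq (t * B ω)]
  have hmem : MemLp f 2 Q := by
    refine MemLp.of_bound hfm 2 (ae_of_all _ fun ω ↦ ?_)
    rw [hf]
    simp only [norm_norm]
    refine (norm_sub_le _ _).trans ?_
    rw [← Complex.ofReal_mul, ← Complex.ofReal_mul, Complex.norm_exp_ofReal_mul_I,
      Complex.norm_exp_ofReal_mul_I]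
    norm_num
  have hvar : (∫ ω, f ω ∂Q) ^ 2 ≤ ∫ ω, f ω ^ 2 ∂Q := by
    have h1 := variance_nonneg f Q
    rw [variance_eq_sub hmem] at h1
    simpa using h1
  have hdiff : ‖charFun (Q.map A) t - charFun (Q.map B) t‖ ≤ ∫ ω, f ω ∂Q := by
    rw [hφ hA, hφ hB, ← integral_sub (hi hA) (hi hB)]
    exact norm_integral_le_integral_norm _
  have hone : Integrable (fun ω ↦ 1 - Complex.exp (t * (A ω - B ω : ℝ) * Complex.I)) Q :=
    (integrable_const _).sub (hi hAB)
  have hre : ∫ ω, f ω ^ 2 ∂Q = 2 * (1 - charFun (Q.map (fun ω ↦ A ω - B ω)) t).re := by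
    simp_rw [hf2]
    rw [integral_const_mul, hφ hAB]
    congr 1
    have h2 : ∫ ω, (1 - Complex.exp (t * (A ω - B ω : ℝ) * Complex.I)) ∂Q
        = 1 - ∫ ω, Complex.exp (t * (A ω - B ω : ℝ) * Complex.I) ∂Q := by
      rw [integral_sub (integrable_const _) (hi hAB)]
      simp
    rw [← h2]
    exact integral_re hone
  calc ‖charFun (Q.map A) t - charFun (Q.map B) t‖ ^ 2 ≤ (∫ ω, f ω ∂Q) ^ 2 := by gcongr
    _ ≤ _ := hvar
    _ = _ := hre
    _ ≤ _ := by gcongr; exact Complex.re_le_norm _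

/-- The perturbation bound for sums of `n` independent copies. -/
lemma sq_norm_charFun_map_pow_sub_le {Ω : Type*} [MeasurableSpace Ω] {Q : Measure Ω}
    [IsProbabilityMeasure Q] {A B : Ω → ℝ} (hA : Measurable A) (hB : Measurable B)
    (n : ℕ) (t : ℝ) :
    ‖charFun (Q.map A) t ^ n - charFun (Q.map B) t ^ n‖ ^ 2
      ≤ 2 * ‖1 - charFun (Q.map (fun ω ↦ A ω - B ω)) t ^ n‖ := by
  -- Both sums use the same coordinates, so their difference is a sum of n independent copies of A -
  -- B.
  set R : Measure (Fin n → Ω) := Measure.pi fun _ ↦ Q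
  have hsum : ∀ {E : Ω → ℝ}, Measurable E →
      charFun (R.map (fun ω ↦ ∑ i, E (ω i))) t = charFun (Q.map E) t ^ n := by
    intro E hE
    have hind : iIndepFun (fun (i : Fin n) (ω : Fin n → Ω) ↦ E (ω i)) R :=
      iIndepFun_pi (X := fun _ ↦ E) fun _ ↦ hE.aemeasurable
    rw [hind.charFun_map_fun_sum_eq_prod (fun i ↦ (by fun_prop : Measurable _).aemeasurable),
      Finset.prod_apply]
    have : ∀ i : Fin n, R.map (fun ω ↦ E (ω i)) = Q.map E := by
      intro i
      rw [← (measurePreserving_eval (fun _ : Fin n ↦ Q) i).map_eq,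
        Measure.map_map hE (by fun_prop)]
      rfl
    simp [this]
  have key := sq_norm_charFun_map_sub_le (Q := R) (A := fun ω ↦ ∑ i, A (ω i))
    (B := fun ω ↦ ∑ i, B (ω i)) (by fun_prop : Measurable _).aemeasurable
    (by fun_prop : Measurable _).aemeasurable t
  simp_rw [← Finset.sum_sub_distrib] at key
  rwa [hsum hA, hsum hB, hsum (E := fun ω ↦ A ω - B ω) (by fun_prop)] at key

/-! ### Atomless limits and uniform convergence. -/

/-- A law on `ℝ` with integrable characteristic function has no atoms. -/
lemma measure_singleton_eq_zero_of_integrable_charFun {ν : Measure ℝ} [IsProbabilityMeasure ν]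
    (h : Integrable (charFun ν)) (a : ℝ) : ν {a} = 0 := by
  -- Translation moves the atom to 0 without changing |φ|. The mean of φ over [-r, r] is then ∫
  -- sinc(rx) dρ, which is O(1/r) yet tends to ρ{0}.
  set ρ := ν.map (fun x ↦ x + (-a)) with hρ
  have hprob : IsProbabilityMeasure ρ := Measure.isProbabilityMeasure_map (by fun_prop)
  have hnorm : ∀ t, ‖charFun ρ t‖ = ‖charFun ν t‖ := by
    intro t
    rw [hρ, charFun_map_add_const, norm_mul, Complex.norm_exp_ofReal_mul_I, mul_one]
  have hρa : ρ {0} = ν {a} := by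
    rw [hρ, Measure.map_apply (by fun_prop) (measurableSet_singleton _)]
    congr 1
    ext x
    simp
  have hbound : ∀ r : ℝ, 0 < r → ‖∫ x, Real.sinc (r * x) ∂ρ‖
      ≤ (2 * r)⁻¹ * ∫ t, ‖charFun ν t‖ := by
    intro r hr
    have h1 : ‖∫ t in -r..r, charFun ρ t‖ ≤ ∫ t, ‖charFun ν t‖ := by
      refine (intervalIntegral.norm_integral_le_integral_norm (by linarith)).trans ?_
      simp_rw [hnorm]
      rw [intervalIntegral.integral_of_le (by linarith)]
      exact setIntegral_le_integral h.norm (ae_of_all _ fun _ ↦ norm_nonneg _)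
    rw [integral_charFun_Icc hr] at h1
    have h2 : ‖2 * (r : ℂ) * ((∫ x, Real.sinc (r * x) ∂ρ : ℝ) : ℂ)‖
        = 2 * r * ‖∫ x, Real.sinc (r * x) ∂ρ‖ := by
      rw [norm_mul, norm_mul, Complex.norm_real, Complex.norm_real, Real.norm_of_nonneg hr.le]
      simp
    rw [h2] at h1
    rwa [← div_eq_inv_mul, le_div_iff₀' (by positivity)]
  have hl1 : Tendsto (fun n : ℕ ↦ ∫ x, Real.sinc (n * x) ∂ρ) atTop (𝓝 0) := by
    have h0 : Tendsto (fun n : ℕ ↦ (2 * (n : ℝ))⁻¹ * ∫ t, ‖charFun ν t‖) atTop (𝓝 0) := by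
      have := (tendsto_natCast_atTop_atTop (R := ℝ)).const_mul_atTop (zero_lt_two (α := ℝ))
      simpa using this.inv_tendsto_atTop.mul_const (∫ t, ‖charFun ν t‖)
    refine squeeze_zero_norm' ?_ h0
    filter_upwards [eventually_gt_atTop 0] with n hn
    exact hbound n (by exact_mod_cast hn)
  have hl2 : Tendsto (fun n : ℕ ↦ ∫ x, Real.sinc (n * x) ∂ρ) atTop
      (𝓝 (∫ x, Set.indicator {(0 : ℝ)} (fun _ ↦ (1 : ℝ)) x ∂ρ)) := by
    refine tendsto_integral_of_dominated_convergence (fun _ ↦ 1) (fun n ↦ by fun_prop)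
      (integrable_const _) (fun n ↦ ae_of_all _ fun x ↦ Real.abs_sinc_le_one _)
      (ae_of_all _ fun x ↦ ?_)
    rcases eq_or_ne x 0 with rfl | hx
    · simp
    · rw [Set.indicator_of_notMem (by simpa using hx)]
      have h0 : Tendsto (fun n : ℕ ↦ ((n : ℝ) * |x|)⁻¹) atTop (𝓝 0) :=
        ((tendsto_natCast_atTop_atTop (R := ℝ)).atTop_mul_const (abs_pos.2 hx)).inv_tendsto_atTop
      refine squeeze_zero_norm' ?_ h0
      filter_upwards [eventually_gt_atTop 0] with n hn
      have hn' : (0 : ℝ) < n := by exact_mod_cast hn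
      have hne : (n : ℝ) * x ≠ 0 := mul_ne_zero hn'.ne' hx
      rw [Real.sinc_of_ne_zero hne, norm_div, Real.norm_eq_abs, Real.norm_eq_abs, abs_mul,
        Nat.abs_cast, ← one_div]
      gcongr
      exact Real.abs_sin_le_one _
  have := tendsto_nhds_unique hl1 hl2
  rw [integral_indicator_const _ (measurableSet_singleton _)] at this
  rw [← hρa]
  simpa [measureReal_def, ENNReal.toReal_eq_zero_iff] using this.symm

lemma tendsto_cdf_of_tendsto {ν : ProbabilityMeasure ℝ} {ρ : ℕ → ProbabilityMeasure ℝ}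
    (h : Tendsto ρ atTop (𝓝 ν)) (hν : ∀ a, (ν : Measure ℝ) {a} = 0) (x : ℝ) :
    Tendsto (fun n ↦ cdf (ρ n : Measure ℝ) x) atTop (𝓝 (cdf (ν : Measure ℝ) x)) := by
  simp_rw [cdf_eq_real]
  have h1 := ProbabilityMeasure.tendsto_measure_of_null_frontier_of_tendsto' h
    (E := Set.Iic x) (by rw [frontier_Iic]; exact hν x)
  exact (ENNReal.tendsto_toReal (measure_ne_top _ _)).comp h1

lemma continuous_cdf_of_measure_singleton {ν : Measure ℝ} [IsProbabilityMeasure ν]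
    (hν : ∀ a, ν {a} = 0) : Continuous (cdf ν) := by
  refine continuous_iff_continuousAt.2 fun a ↦ ?_
  have h := (cdf ν).measure_singleton a
  rw [measure_cdf, hν a, eq_comm, ENNReal.ofReal_eq_zero, sub_nonpos] at h
  rw [(monotone_cdf ν).continuousAt_iff_leftLim_eq_rightLim, (cdf ν).rightLim_eq]
  exact le_antisymm ((monotone_cdf ν).leftLim_le le_rfl) h

/-- **Pólya's theorem**: weak convergence to a law without atoms is uniform convergence of the
distribution functions. -/
theorem tendsto_kolmogorovDist_of_tendsto {ν : ProbabilityMeasure ℝ}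
    {ρ : ℕ → ProbabilityMeasure ℝ}
    (h : Tendsto ρ atTop (𝓝 ν)) (hν : ∀ a, (ν : Measure ℝ) {a} = 0) :
    Tendsto (fun n ↦ kolmogorovDist (ρ n : Measure ℝ) (ν : Measure ℝ)) atTop (𝓝 0) := by
  set F := cdf (ν : Measure ℝ)
  set Fn : ℕ → ℝ → ℝ := fun n ↦ cdf (ρ n : Measure ℝ)
  have hpt : ∀ x, Tendsto (fun n ↦ Fn n x) atTop (𝓝 (F x)) := tendsto_cdf_of_tendsto h hν
  have hcont : Continuous F := continuous_cdf_of_measure_singleton hν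
  have hmono : Monotone F := monotone_cdf _
  have hmono' : ∀ n, Monotone (Fn n) := fun n ↦ monotone_cdf _
  -- Monotonicity traps both functions on [a - δ/2, a + δ/2] between their endpoint values.
  have hloc : TendstoLocallyUniformly Fn F atTop := by
    rw [Metric.tendstoLocallyUniformly_iff]
    intro ε hε a
    obtain ⟨δ, hδ, hδ'⟩ := Metric.continuousAt_iff.1 (hcont.continuousAt (x := a)) (ε / 4)
      (by positivity)
    have hb := hδ' (x := a - δ / 2) (by
      rw [Real.dist_eq, sub_sub_cancel_left, abs_neg, abs_of_pos (by positivity)]; linarith)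
    have hc := hδ' (x := a + δ / 2) (by
      rw [Real.dist_eq, add_sub_cancel_left, abs_of_pos (by positivity)]; linarith)
    rw [Real.dist_eq, abs_lt] at hb hc
    refine ⟨Set.Icc (a - δ / 2) (a + δ / 2), Icc_mem_nhds (by linarith) (by linarith), ?_⟩
    filter_upwards [Metric.tendsto_nhds.1 (hpt (a - δ / 2)) (ε / 4) (by positivity),
      Metric.tendsto_nhds.1 (hpt (a + δ / 2)) (ε / 4) (by positivity)] with n h1 h2 x hx
    rw [Real.dist_eq, abs_lt] at h1 h2 ⊢
    have := hmono hx.1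
    have := hmono hx.2
    have := hmono' n hx.1
    have := hmono' n hx.2
    constructor <;> linarith
  rw [Metric.tendsto_nhds]
  intro ε hε
  -- Outside [a, b] both functions are uniformly close to 0 or to 1, so only a compact interval
  -- remains.
  obtain ⟨a, ha⟩ := ((tendsto_cdf_atBot (ν : Measure ℝ)).eventually
    (gt_mem_nhds (show (0 : ℝ) < ε / 4 by positivity))).exists
  obtain ⟨b, hb⟩ := ((tendsto_cdf_atTop (ν : Measure ℝ)).eventually
    (lt_mem_nhds (show 1 - ε / 4 < (1 : ℝ) by linarith))).exists
  have hunif := (tendstoLocallyUniformlyOn_iff_tendstoUniformlyOn_of_compact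
    (isCompact_Icc (a := a) (b := b))).1 hloc.tendstoLocallyUniformlyOn
  filter_upwards [Metric.tendstoUniformlyOn_iff.1 hunif (ε / 2) (by positivity),
    Metric.tendsto_nhds.1 (hpt a) (ε / 4) (by positivity),
    Metric.tendsto_nhds.1 (hpt b) (ε / 4) (by positivity)] with n h1 h2 h3
  have hle : kolmogorovDist (ρ n : Measure ℝ) (ν : Measure ℝ) ≤ ε / 2 := by
    refine ciSup_le fun x ↦ ?_
    change |Fn n x - F x| ≤ ε / 2
    have p1 : 0 ≤ F x := cdf_nonneg _ x
    have p2 : F x ≤ 1 := cdf_le_one _ x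
    have p3 : 0 ≤ Fn n x := cdf_nonneg _ x
    have p4 : Fn n x ≤ 1 := cdf_le_one _ x
    rw [Real.dist_eq, abs_lt] at h2 h3
    rcases lt_or_ge x a with hxa | hxa
    · have := hmono hxa.le
      have := hmono' n hxa.le
      exact abs_le.2 ⟨by linarith, by linarith⟩
    rcases lt_or_ge b x with hxb | hxb
    · have := hmono hxb.le
      have := hmono' n hxb.le
      exact abs_le.2 ⟨by linarith, by linarith⟩
    · have := h1 x ⟨hxa, hxb⟩
      rw [dist_comm, Real.dist_eq] at this
      exact this.le
  have hnn : 0 ≤ kolmogorovDist (ρ n : Measure ℝ) (ν : Measure ℝ) :=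
    Real.iSup_nonneg fun _ ↦ abs_nonneg _
  rw [Real.dist_eq, sub_zero, abs_of_nonneg hnn]
  linarith

/-- The Kolmogorov distance is invariant under increasing affine maps. -/
lemma kolmogorovDist_map_affine (ρ ν : Measure ℝ) [IsProbabilityMeasure ρ]
    [IsProbabilityMeasure ν] {c : ℝ} (hc : 0 < c) (b : ℝ) :
    kolmogorovDist (ρ.map (fun x ↦ c * x + b)) (ν.map (fun x ↦ c * x + b))
      = kolmogorovDist ρ ν := by
  have hcdf : ∀ (κ : Measure ℝ) [IsProbabilityMeasure κ] (x : ℝ),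
      cdf (κ.map (fun x ↦ c * x + b)) (c * x + b) = cdf κ x := by
    intro κ _ x
    have : IsProbabilityMeasure (κ.map (fun x ↦ c * x + b)) :=
      Measure.isProbabilityMeasure_map (by fun_prop)
    rw [cdf_eq_real, cdf_eq_real, map_measureReal_apply (by fun_prop) measurableSet_Iic]
    congr 1
    ext y
    simp [hc]
  have hsurj : Function.Surjective (fun x : ℝ ↦ c * x + b) := fun y ↦
    ⟨(y - b) / c, by field_simp; ring⟩
  unfold kolmogorovDist
  rw [← hsurj.iSup_comp]
  simp_rw [hcdf]

/-! ### Attraction to the stable law. -/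

lemma IsStableLaw.measure_singleton_eq_zero {α σ : ℝ} (hα : 1 < α) (hσ : 0 < σ)
    {ν : ProbabilityMeasure ℝ} (h : IsStableLaw α σ 0 0 ν) (a : ℝ) :
    (ν : Measure ℝ) {a} = 0 := by
  refine measure_singleton_eq_zero_of_integrable_charFun ?_ a
  have hreal : Integrable (fun t : ℝ ↦ Real.exp (-(σ ^ α) * ‖t‖ ^ α)) := by
    rw [integrable_fun_norm_addHaar volume (f := fun y : ℝ ↦ Real.exp (-(σ ^ α) * y ^ α))]
    simpa using integrableOn_rpow_mul_exp_neg_mul_rpow (s := 0) (p := α) (b := σ ^ α)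
      (by norm_num) (by linarith) (by positivity)
  refine hreal.ofReal.congr (ae_of_all _ fun t ↦ ?_)
  rw [h.charFun_eq_ofReal hα.ne']
  simp

/-- Strict stability: n · (n^(-1/α))^α = 1. It fails at n = 0, where the left side is 1. -/
lemma IsStableLaw.charFun_scaled_pow {α σ : ℝ} (hα : 1 < α) {ν : ProbabilityMeasure ℝ}
    (h : IsStableLaw α σ 0 0 ν) {n : ℕ} (hn : n ≠ 0) (t : ℝ) :
    charFun (ν : Measure ℝ) (((n : ℝ) ^ (1 / α))⁻¹ * t) ^ n = charFun (ν : Measure ℝ) t := by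
  have hn' : (0 : ℝ) < n := by positivity
  rw [h.charFun_eq_ofReal hα.ne', h.charFun_eq_ofReal hα.ne', ← Complex.ofReal_pow,
    ← Real.exp_nat_mul, abs_mul, Real.mul_rpow (abs_nonneg _) (abs_nonneg _),
    abs_of_nonneg (by positivity), Real.inv_rpow (by positivity), ← Real.rpow_mul hn'.le,
    one_div_mul_cancel (by linarith), Real.rpow_one]
  congr 3
  field_simp

/-- Finite Mallows distance of order `α` to a centred symmetric stable law entails attraction to
that law, in terms of characteristic functions. -/
lemma tendsto_charFun_pow_of_coupling {Ω : Type*} [MeasurableSpace Ω] {Q : Measure Ω}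
    [IsProbabilityMeasure Q] {A B : Ω → ℝ} (hA : Measurable A) (hB : Measurable B)
    {α σ : ℝ} (hα₁ : 1 < α) (hα₂ : α < 2) {H : ProbabilityMeasure ℝ}
    (hH : IsStableLaw α σ 0 0 H) (hBH : Q.map B = H)
    (hD : Integrable (fun ω ↦ A ω - B ω) Q) (hD₀ : ∫ ω, (A ω - B ω) ∂Q = 0)
    (hDα : Integrable (fun ω ↦ |A ω - B ω| ^ α) Q) (t : ℝ) :
    Tendsto (fun n : ℕ ↦ charFun (Q.map A) (((n : ℝ) ^ (1 / α))⁻¹ * t) ^ n) atTop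
      (𝓝 (charFun (H : Measure ℝ) t)) := by
  have h1 := tendsto_charFun_pow_one hα₁ hα₂ hD hD₀ hDα t
  have h2 : Tendsto (fun n : ℕ ↦ √(2 * ‖1 - charFun (Q.map fun ω ↦ A ω - B ω)
      (((n : ℝ) ^ (1 / α))⁻¹ * t) ^ n‖)) atTop (𝓝 0) := by
    have := (((tendsto_const_nhds (x := (1 : ℂ))).sub h1).norm.const_mul 2).sqrt
    simpa using this
  rw [tendsto_iff_norm_sub_tendsto_zero]
  refine squeeze_zero' (Eventually.of_forall fun _ ↦ norm_nonneg _) ?_ h2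
  filter_upwards [eventually_ne_atTop 0] with n hn
  refine Real.le_sqrt_of_sq_le ?_
  have := sq_norm_charFun_map_pow_sub_le (Q := Q) hA hB n (((n : ℝ) ^ (1 / α))⁻¹ * t)
  rwa [hBH, hH.charFun_scaled_pow hα₁ hn] at this

lemma charFun_map_sum_sub_div {Ω : Type*} [MeasurableSpace Ω] {P : Measure Ω}
    [IsProbabilityMeasure P] {X : ℕ → Ω → ℝ} (hindep : iIndepFun X P)
    (hident : ∀ j, IdentDistrib (X j) (X 0) P P) (m c : ℝ) (n : ℕ) (t : ℝ) :
    charFun (P.map fun ω ↦ ((∑ j ∈ Finset.range n, X j ω) - n * m) / c) t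
      = charFun (P.map fun ω ↦ X 0 ω - m) (c⁻¹ * t) ^ n := by
  have hX : ∀ j, AEMeasurable (X j) P := fun j ↦ (hident j).aemeasurable_fst
  have hfun : (fun ω ↦ ((∑ j ∈ Finset.range n, X j ω) - n * m) / c)
      = fun ω ↦ c⁻¹ * ∑ j ∈ Finset.range n, (X j ω - m) := by
    funext ω
    rw [Finset.sum_sub_distrib]
    simp [div_eq_inv_mul]
  have hind : iIndepFun (fun j ω ↦ X j ω - m) P :=
    hindep.comp (fun _ x ↦ x - m) (by fun_prop)
  have hsum : AEMeasurable (fun ω ↦ ∑ j ∈ Finset.range n, (X j ω - m)) P :=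
    Finset.aemeasurable_fun_sum _ fun j _ ↦ (hX j).sub_const m
  rw [hfun, charFun_map_mul_comp hsum,
    (hind.restrict _).charFun_map_fun_finsetSum_eq_prod (fun j _ ↦ (hX j).sub_const m),
      Finset.prod_apply]
  have : ∀ j, P.map (fun ω ↦ X j ω - m) = P.map (fun ω ↦ X 0 ω - m) := fun j ↦
    ((hident j).comp (u := fun x ↦ x - m) (by fun_prop)).map_eq
  simp [this]

theorem proposition2p3 {Ω : Type*} [MeasurableSpace Ω] (P : Measure Ω) [IsProbabilityMeasure P]
    (X : ℕ → Ω → ℝ) (hindep : iIndepFun X P) (hident : ∀ j, IdentDistrib (X j) (X 0) P P)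
    (α σ μ : ℝ) (hα₁ : 1 < α) (hα₂ : α < 2) (hσ : 0 < σ)
    (G : ProbabilityMeasure ℝ) (hG : IsStableLaw α σ 0 μ G)
    (hd : mallowsDist α (P.map (X 0)) (G : Measure ℝ) < ⊤) :
    Integrable (X 0) P ∧
    (∃ H : ProbabilityMeasure ℝ, IsStableLaw α σ 0 0 H ∧
      TendstoInDistribution
        (fun (n : ℕ) ω ↦
          ((∑ j ∈ Finset.range n, X j ω) - (n : ℝ) * ∫ ω', X 0 ω' ∂P) / (n : ℝ) ^ (1 / α))
        atTop (id : ℝ → ℝ) (fun _ ↦ P) (H : Measure ℝ)) ∧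
    (∃ K : ℕ → ProbabilityMeasure ℝ,
      (∀ n : ℕ, IsStableLaw α (σ * (n : ℝ) ^ (1 / α)) 0 ((n : ℝ) * ∫ ω, X 0 ω ∂P) (K n)) ∧
      Tendsto
        (fun n : ℕ ↦ kolmogorovDist (P.map (fun ω ↦ ∑ j ∈ Finset.range n, X j ω))
          (K n : Measure ℝ))
        atTop (𝓝 0)) := by
  have hX : ∀ j, AEMeasurable (X j) P := fun j ↦ (hident j).aemeasurable_fst
  obtain ⟨π, hπ₁, hπ₂, hπα⟩ := exists_coupling_of_mallowsDist_lt_top (by linarith) hd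
  have hFprob : IsProbabilityMeasure (P.map (X 0)) := Measure.isProbabilityMeasure_map (hX 0)
  have hπprob : IsProbabilityMeasure π := by
    refine ⟨?_⟩
    rw [← measure_univ (μ := P.map (X 0)), ← hπ₁,
      Measure.map_apply measurable_fst MeasurableSet.univ, Set.preimage_univ]
  -- the centred limit law
  set H : ProbabilityMeasure ℝ := G.map (f := fun x ↦ 1 * x + -μ) (by fun_prop) with hHdef
  have hH : IsStableLaw α σ 0 0 H := by
    have := hG.map_affine hα₁ hσ.le zero_le_one (-μ)
    rwa [mul_one, one_mul, add_neg_cancel] at this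
  have hBH : π.map (fun p ↦ 1 * p.2 + -μ) = H := by
    rw [hHdef, ProbabilityMeasure.toMeasure_map, ← hπ₂,
      Measure.map_map (by fun_prop) (by fun_prop)]
    rfl
  have hBint : Integrable (fun p : ℝ × ℝ ↦ 1 * p.2 + -μ) π := by
    have := hH.integrable_id hα₁ hσ.le
    rw [← hBH] at this
    exact (integrable_map_measure (by fun_prop) (by fun_prop)).1 this
  have hB₀ : ∫ p : ℝ × ℝ, (1 * p.2 + -μ) ∂π = 0 := by
    rw [← hH.integral_id_eq_zero hα₁.ne', ← hBH, integral_map (by fun_prop) (by fun_prop)]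
  -- moments of the coupling
  have hmem : ∀ b : ℝ, MemLp (fun p : ℝ × ℝ ↦ p.1 - p.2 - b) (ENNReal.ofReal α) π := by
    intro b
    refine MemLp.sub (f := fun p : ℝ × ℝ ↦ p.1 - p.2) ⟨by fun_prop, ?_⟩ (memLp_const b)
    rw [eLpNorm_lt_top_iff_lintegral_rpow_enorm_lt_top (by simp; linarith) (by simp),
      ENNReal.toReal_ofReal (by linarith)]
    convert hπα using 3 with p
    rw [← ofReal_norm, Real.norm_eq_abs, ENNReal.ofReal_rpow_of_nonneg (abs_nonneg _) (by linarith)]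
  have hDint : ∀ b : ℝ, Integrable (fun p : ℝ × ℝ ↦ p.1 - p.2 - b) π := fun b ↦
    (hmem b).integrable (by simpa using hα₁.le)
  have hfst : Integrable (fun p : ℝ × ℝ ↦ p.1) π := by
    refine (((hDint 0).add hBint).add (integrable_const μ)).congr (ae_of_all _ fun p ↦ ?_)
    simp only [Pi.add_apply]
    ring
  have hXint : Integrable (X 0) P := by
    have : Integrable (fun x : ℝ ↦ x) (P.map (X 0)) := by
      rw [← hπ₁]
      exact (integrable_map_measure (by fun_prop) (by fun_prop)).2 hfst
    exact (integrable_map_measure (by fun_prop) (hX 0)).1 this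
  set m := ∫ ω, X 0 ω ∂P
  have hfst₀ : ∫ p : ℝ × ℝ, p.1 ∂π = m := by
    have h1 : ∫ x, x ∂(P.map (X 0)) = m := integral_map (hX 0) (by fun_prop)
    rw [← h1, ← hπ₁, integral_map (by fun_prop) (by fun_prop)]
  have hAm : π.map (fun p ↦ p.1 - m) = P.map (fun ω ↦ X 0 ω - m) := by
    have h1 : P.map (fun ω ↦ X 0 ω - m) = (P.map (X 0)).map (fun x ↦ x - m) := by
      rw [AEMeasurable.map_map_of_aemeasurable (by fun_prop) (hX 0)]
      rfl
    rw [h1, ← hπ₁, Measure.map_map (by fun_prop) (by fun_prop)]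
    rfl
  have hAint : Integrable (fun p : ℝ × ℝ ↦ p.1 - m) π := hfst.sub (integrable_const _)
  have hD : ∀ p : ℝ × ℝ, p.1 - m - (1 * p.2 + -μ) = p.1 - p.2 - (m - μ) := fun p ↦ by ring
  -- convergence in distribution
  set T : ℕ → Ω → ℝ := fun n ω ↦
    ((∑ j ∈ Finset.range n, X j ω) - (n : ℝ) * m) / (n : ℝ) ^ (1 / α) with hT
  have hTm : ∀ n, AEMeasurable (T n) P := fun n ↦
    ((Finset.aemeasurable_fun_sum _ fun j _ ↦ hX j).sub_const _).div_const _
  have hcf : ∀ t, Tendsto (fun n ↦ charFun (P.map (T n)) t) atTop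
      (𝓝 (charFun (H : Measure ℝ) t)) := by
    intro t
    have key := tendsto_charFun_pow_of_coupling (Q := π) (A := fun p ↦ p.1 - m)
      (B := fun p ↦ 1 * p.2 + -μ) (by fun_prop) (by fun_prop) hα₁ hα₂ hH hBH
      (hAint.sub hBint) ?_ ?_ t
    · rw [hAm] at key
      refine key.congr fun n ↦ ?_
      rw [hT, charFun_map_sum_sub_div hindep hident]
    · rw [integral_sub hAint hBint, hB₀, integral_sub hfst (integrable_const _), hfst₀]
      simp
    · simp_rw [hD]
      have := (hmem (m - μ)).integrable_norm_rpow (by simp; linarith) (by simp)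
      simpa [ENNReal.toReal_ofReal (zero_le_one.trans hα₁.le)] using this
  have hconv : Tendsto (β := ProbabilityMeasure ℝ)
      (fun n ↦ ⟨P.map (T n), Measure.isProbabilityMeasure_map (hTm n)⟩) atTop (𝓝 H) :=
    ProbabilityMeasure.tendsto_iff_tendsto_charFun.2 hcf
  refine ⟨hXint, ⟨H, hH, hTm, by fun_prop, ?_⟩,
    fun n ↦ H.map (f := fun x ↦ (n : ℝ) ^ (1 / α) * x + n * m) (by fun_prop), fun n ↦ ?_, ?_⟩
  · convert hconv using 2
    exact congrArg 𝓝 (Subtype.ext Measure.map_id)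
  · simpa using hH.map_affine hα₁ hσ.le (c := (n : ℝ) ^ (1 / α)) (by positivity) (n * m)
  · refine (tendsto_kolmogorovDist_of_tendsto hconv
      (hH.measure_singleton_eq_zero hα₁ hσ)).congr' ?_
    -- At n = 0 the scale n^(1/α) vanishes and the affine map is not invertible.
    filter_upwards [eventually_ne_atTop 0] with n hn
    have hn' : (0 : ℝ) < (n : ℝ) ^ (1 / α) := by positivity
    have hprob : IsProbabilityMeasure (P.map (T n)) := Measure.isProbabilityMeasure_map (hTm n)
    have hS : P.map (fun ω ↦ ∑ j ∈ Finset.range n, X j ω)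
        = (P.map (T n)).map (fun x ↦ (n : ℝ) ^ (1 / α) * x + n * m) := by
      rw [AEMeasurable.map_map_of_aemeasurable (by fun_prop) (hTm n)]
      congr 1
      funext ω
      simp only [hT, Function.comp_apply]
      rw [mul_div_cancel₀ _ hn'.ne', sub_add_cancel]
    rw [hS]
    exact (kolmogorovDist_map_affine (P.map (T n)) H hn' _).symm
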